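/- A *tree* is a partial order $(T,<_T)$ in which the set of predecessors $\{s\in T: s<_T t\}$ of every $t\in T$ is well ordered; the height of $t$ is the order type of this set, and the height of $T$ is the least ordinal greater than the heights of all $t\in T$. All trees that $\mathrm{RC}^B$ speaks about have height $\omega_1$, have a unique minimal element, are non-trivial (every $t\in T$ has two incompatible extensions) and do not split on limit levels (if $s,s'$ have the same limit height and the same predecessors, then $s=s'$). A tree is *Baire* if, as a forcing notion in which larger elements are stronger conditions, it is $\omega$-distributive, that is, it adds no new $\omega$-sequences of ordinals. A partial order $T$ is *special* if there is $g:T\to\omega$ that is injective on chains, and *nonspecial* otherwise. The *Baire version of Rado's Conjecture*, $\mathrm{RC}^B$, is the assertion: every Baire tree has a nonspecial subtree (a subset with the induced order) of size $\aleph_1$. For a cardinal $\mu$, $\mathrm{ADS}_\mu$ is the assertion that there is a sequence $\langle A_i : i<\mu^+\rangle$ of unbounded subsets of $\mu$ such that for each $\beta<\mu^+$ there is $F:\beta\to\mu$ for which the sets $A_i\setminus F(i)$, $i<\beta$, are pairwise disjoint. **Proposition.** $\mathrm{RC}^B$ implies that $\mathrm{ADS}_\mu$ fails for every singular cardinal $\mu$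 with $\mathrm{cf}(\mu)=\omega$. -/

import Mathlib

universe u

/-- A partial order is a tree if the strict predecessors of each element are well ordered. -/
class IsOrderTree (T : Type u) [PartialOrder T] : Prop where
  wo : ∀ t : T, IsWellOrder (Set.Iio t) (· < ·)

instance (T : Type u) [PartialOrder T] [IsOrderTree T] (t : T) :
    IsWellOrder (Set.Iio t) (· < ·) := IsOrderTree.wo t

namespace OrderTree

/-- The height of `t` in `T`: the order type of its set of strict predecessors. -/
noncomputable def ht {T : Type u} [PartialOrder T] [IsOrderTree T] (t : T) : Ordinal.{u} :=
  Ordinal.type (α := Set.Iio t) (· < ·)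

/-- `o` is the height of the tree: the least ordinal above the heights of all elements. -/
def HasHeight (T : Type u) [PartialOrder T] [IsOrderTree T] (o : Ordinal.{u}) : Prop :=
  IsLeast {a : Ordinal.{u} | ∀ t : T, ht t < a} o

/-- Two elements are incompatible if they have no common extension
(trees are ordered upwards: larger elements are stronger conditions). -/
def Incompatible {P : Type u} [PartialOrder P] (s t : P) : Prop :=
  ¬ ∃ r : P, s ≤ r ∧ t ≤ r

/-- Every element has two incompatible extensions. -/
def Nontriv (P : Type u) [PartialOrder P] : Prop :=
  ∀ t : P, ∃ s s' : P, t ≤ s ∧ t ≤ s' ∧ Incompatible s s'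

/-- No splitting on limit levels: two elements of the same limit height with the same strict
predecessors are equal. -/
def NoLimitSplit (T : Type u) [PartialOrder T] [IsOrderTree T] : Prop :=
  ∀ s s' : T, Order.IsSuccLimit (ht s) → ht s = ht s' → Set.Iio s = Set.Iio s' → s = s'

/-- The class of trees considered: of height `ω₁`, non-trivial, with a unique minimal element
and not splitting on limit levels. -/
structure IsOmegaOneTree (T : Type u) [PartialOrder T] [IsOrderTree T] : Prop where
  height : HasHeight T (Ordinal.omega 1)
  nontriv : Nontriv T
  root : ∃! r : T, IsMin r
  noLimitSplit : NoLimitSplit T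

/-- A tree is special if there is a function to `ω` that is injective on chains. -/
def IsSpecial (T : Type u) [PartialOrder T] : Prop :=
  ∃ g : T → ℕ, ∀ C : Set T, IsChain (· ≤ ·) C → Set.InjOn g C

/-- A `P`-name for an `ω`-sequence of ordinals, given by the conditions that decide its values:
`decides p n a` says that the condition `p` puts `(n, a)` into the sequence. The name evaluates,
for a generic filter `G`, to the function `{(n, a) | ∃ p ∈ G, decides p n a}`. -/
structure OrdSeqName (P : Type u) [PartialOrder P] where
  decides : P → ℕ → Ordinal.{u} → Prop
  mono : ∀ {p q : P} {n : ℕ} {a : Ordinal.{u}}, p ≤ q → decides p n a → decides q n a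
  functional : ∀ {p : P} {n : ℕ} {a b : Ordinal.{u}}, decides p n a → decides p n b → a = b
  total : ∀ (p : P) (n : ℕ), ∃ q, p ≤ q ∧ ∃ a, decides q n a

/-- `p` forces the sequence named by `τ` to be the ground model sequence `g`. -/
def OrdSeqName.ForcesEq {P : Type u} [PartialOrder P] (τ : OrdSeqName P) (p : P)
    (g : ℕ → Ordinal.{u}) : Prop :=
  ∀ (n : ℕ) (q : P), p ≤ q → ∃ r, q ≤ r ∧ τ.decides r n (g n)

/-- A poset is `ω`-distributive if it is non-trivial and forcing with it adds no new
`ω`-sequences of ordinals: every condition can be strengthened so as to force a given name for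
such a sequence to be a ground model sequence. -/
def IsOmegaDistributive (P : Type u) [PartialOrder P] : Prop :=
  Nontriv P ∧ ∀ (τ : OrdSeqName P) (p : P), ∃ q, p ≤ q ∧ ∃ g : ℕ → Ordinal.{u}, τ.ForcesEq q g

end OrderTree

open OrderTree in
/-- The Baire version of Rado's Conjecture: every Baire (that is, `ω`-distributive) tree has a
nonspecial subtree (a subset with the induced order) of size `ℵ₁`. -/
def BaireRadoConjecture : Prop :=
  ∀ (T : Type u) [PartialOrder T] [IsOrderTree T], IsOmegaOneTree T → IsOmegaDistributive T →
    ∃ X : Set T, Cardinal.mk X = Cardinal.aleph 1 ∧ ¬ IsSpecial X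

/-- `A i`, for `i < μ⁺`, is an almost disjoint sequence of unbounded subsets of `μ`: for each
`β < μ⁺` there is `F : β → μ` such that the sets `A i \ F i`, `i < β`, are pairwise disjoint.
Cardinals are identified with their initial ordinals, and `F i` with the set of smaller ordinals. -/
def IsAlmostDisjointSeq (μ : Cardinal.{u}) (A : Set.Iio (Order.succ μ).ord → Set (Set.Iio μ.ord)) :
    Prop :=
  (∀ i, ∀ a : Set.Iio μ.ord, ∃ b ∈ A i, a < b) ∧
  ∀ β : Set.Iio (Order.succ μ).ord, ∃ F : Set.Iio β → Set.Iio μ.ord,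
    ∀ i j : Set.Iio β, i ≠ j → Disjoint (A i \ Set.Iio (F i)) (A j \ Set.Iio (F j))

/-- The principle `ADS_μ`. -/
def ADS (μ : Cardinal.{u}) : Prop :=
  ∃ A : Set.Iio (Order.succ μ).ord → Set (Set.Iio μ.ord), IsAlmostDisjointSeq μ A

/-!
Let `A i`, `i < μ⁺`, be an `ADS_μ`-sequence. Consider the tree `GuessingSeq` of sequences of
countable length, with terms `(κ_w, x_w)` in `μ⁺ × μ`, such that `κ` is strictly increasing and,
at every limit `b` up to and including the length, the set `A δ ∩ {x_w : w < b}` is unbounded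
in `μ`, where `δ = sup {κ_w : w < b}`.

The tree is Baire (`GuessingSeq.exists_le_forall_mem`): given dense upward closed sets `D n`,
build sets `G n` of at most `μ` sequences and ordinals `γ n < μ⁺` such that every sequence in
`G n` can be continued by `(γ n, x)`, for any `x < μ`, and then extended into `G (n + 1) ∩ D n`.
The ordinal `δ = sup γ n` does not depend on the choices of `x`, so these may be taken along a
cofinal `ω`-sequence of elements of `A δ`, which exists as `cf μ = ω`. The union of the resulting
branch satisfies the limit condition and lies in every `D n`. Applied along cofinal sequences of
countable limits, the same fact shows that the tree has height `ω₁` (`GuessingSeq.exists_le_len`).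

A subtree of size `ℵ₁ ≤ μ` has all its `κ_w` below some `γ < μ⁺`, so let `F` make the sets `A i`,
`i ≤ γ`, disjoint. A sequence of limit length with supremum `δ` has some `x_w` in `A δ \ F δ`; send
it to its restriction to `w`. If two comparable sequences have the same image, they share `x_w`
while having different suprema, which contradicts disjointness. So this regressive map is injective
on chains of sequences of limit length; a sequence of successor length is sent to its immediate
predecessor. A finite descent along the map shows that the subtree is special
(`isSpecial_of_regressive`, `GuessingSeq.isSpecial_of_disjoint`), contrary to `RC^B`.
-/

open Cardinal Order

/-! ### Special trees -/

/-- A regressive map on a well-founded order in which elements below a common element are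
comparable yields specialness, as soon as the non-minimal elements of each fiber form a countable
union of antichains, indexed by the colours `c`.
The witness codes `t` by the list of colours met along the descent `t, f t, f (f t), …`. -/
theorem isSpecial_of_regressive {T : Type u} [PartialOrder T] [WellFoundedLT T]
    (hT : ∀ {r s t : T}, r ≤ t → s ≤ t → r ≤ s ∨ s ≤ r)
    (hmin : ∀ {s t : T}, IsMin s → IsMin t → s = t)
    (f : T → T) (hf : ∀ t, ¬ IsMin t → f t < t) (c : T → ℕ)
    (hc : ∀ s t, ¬ IsMin s → ¬ IsMin t → s < t → f s = f t → c s ≠ c t) :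
    OrderTree.IsSpecial T := by
  classical
  have hcode : ∃ g : T → List ℕ, ∀ t, g t = if IsMin t then [] else c t :: g (f t) := by
    let g : T → List ℕ := WellFounded.fix (wellFounded_lt (α := T)) fun t ih =>
      if h : IsMin t then [] else c t :: ih (f t) (hf t h)
    refine ⟨g, fun t => ?_⟩
    simp only [g]
    rw [WellFounded.fix_eq]
    split_ifs <;> rfl
  obtain ⟨g, hg⟩ := hcode
  -- Equal codes of comparable elements are resolved from the end of the descent backwards: the
  -- images under `f` are comparable, hence equal by induction.
  have key : ∀ t s, (s ≤ t ∨ t ≤ s) → g s = g t → s = t := by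
    intro t
    induction t using WellFoundedLT.induction with
    | ind t ih =>
      intro s hst h
      rw [hg s, hg t] at h
      by_cases hs : IsMin s <;> by_cases ht : IsMin t <;> simp only [hs, ht, if_true, if_false] at h
      · exact hmin hs ht
      · cases h
      · cases h
      · obtain ⟨h₁, h₂⟩ := List.cons.inj h
        have hcomp : f s ≤ f t ∨ f t ≤ f s := by
          rcases hst with hst | hst
          · exact hT ((hf s hs).le.trans hst) (hf t ht).le
          · exact hT (hf s hs).le ((hf t ht).le.trans hst)
        have hfe := ih (f t) (hf t ht) (f s) hcomp h₂
        by_contra hne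
        rcases hst with hst | hst
        · exact hc s t hs ht (lt_of_le_of_ne hst hne) hfe h₁
        · exact hc t s ht hs (lt_of_le_of_ne hst (Ne.symm hne)) hfe.symm h₁.symm
  refine ⟨fun t => Encodable.encode (g t), fun C hC s hs t ht h => ?_⟩
  exact key t s (hC.total hs ht) (Encodable.encode_injective h)

theorem OrderTree.IsSpecial.of_orderEmbedding {S T : Type u} [PartialOrder S] [PartialOrder T]
    (hT : OrderTree.IsSpecial T) (e : S ↪o T) : OrderTree.IsSpecial S := by
  obtain ⟨g, hg⟩ := hT
  refine ⟨g ∘ e, fun C hC => ?_⟩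
  refine Set.InjOn.comp (hg (e '' C) ?_) e.injective.injOn (Set.mapsTo_image _ _)
  rintro _ ⟨a, ha, rfl⟩ _ ⟨b, hb, rfl⟩ _
  simpa using hC.total ha hb

/-! ### The tree of guessing sequences -/

/-- The terms `(κ_w, x_w)`, `w < b`, of a sequence in `K × M` guess `A` at `b`: for
`δ = sup {κ_w : w < b}`, the set `A δ ∩ {x_w : w < b}` is unbounded in `M`. -/
def GuessesAt {K M W : Type u} [LinearOrder K] [LinearOrder M] [LinearOrder W] (A : K → Set M)
    (val : W → K × M) (b : W) : Prop :=
  ∃ δ, IsLUB {k | ∃ w < b, (val w).1 = k} δ ∧ ∀ x, ∃ w < b, (val w).2 ∈ A δ ∧ x < (val w).2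

theorem GuessesAt.congr {K M W : Type u} [LinearOrder K] [LinearOrder M] [LinearOrder W]
    {A : K → Set M} {f g : W → K × M} {b : W} (hf : GuessesAt A f b) (h : ∀ w < b, f w = g w) :
    GuessesAt A g b := by
  obtain ⟨δ, hδ, hx⟩ := hf
  have hset : {k | ∃ w < b, (f w).1 = k} = {k | ∃ w < b, (g w).1 = k} := by
    ext k
    exact exists_congr fun w => and_congr_right fun hw => by rw [h w hw]
  refine ⟨δ, hset ▸ hδ, fun x => ?_⟩
  obtain ⟨w, hw, hwx⟩ := hx x
  exact ⟨w, hw, h w hw ▸ hwx⟩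

/-- The sequences `⟨(κ_w, x_w) : w < len⟩` of elements of `K × M` such that `κ` is strictly
increasing and `A` is guessed at every limit `b ≤ len`. A sequence is encoded as a total function
on `W`, with the default value from `len` on. -/
@[ext]
structure GuessingSeq {K M : Type u} (W : Type u) [LinearOrder K] [LinearOrder M] [LinearOrder W]
    [Inhabited K] [Inhabited M] (A : K → Set M) where
  /-- the length of the sequence -/
  len : W
  /-- the terms of the sequence -/
  val : W → K × M
  val_of_le : ∀ w, len ≤ w → val w = default
  fst_lt : ∀ v w, v < w → w < len → (val v).1 < (val w).1
  guess : ∀ b ≤ len, IsSuccLimit b → GuessesAt A val b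

namespace GuessingSeq

variable {K M W : Type u} [LinearOrder K] [LinearOrder M] [LinearOrder W]
  [Inhabited K] [Inhabited M] {A : K → Set M}

/-- Sequences are ordered by end-extension. -/
instance : PartialOrder (GuessingSeq W A) where
  le s t := s.len ≤ t.len ∧ ∀ w < s.len, s.val w = t.val w
  le_refl s := ⟨le_rfl, fun _ _ => rfl⟩
  le_trans r s t hrs hst := ⟨hrs.1.trans hst.1, fun w hw =>
    (hrs.2 w hw).trans (hst.2 w (hw.trans_le hrs.1))⟩
  le_antisymm s t hst hts := by
    have hl := le_antisymm hst.1 hts.1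
    refine GuessingSeq.ext hl (funext fun w => ?_)
    rcases lt_or_ge w s.len with hw | hw
    · exact hst.2 w hw
    · rw [s.val_of_le w hw, t.val_of_le w (hl ▸ hw)]

theorem le_of_le_of_len_le {r s t : GuessingSeq W A} (hr : r ≤ t) (hs : s ≤ t)
    (h : r.len ≤ s.len) : r ≤ s :=
  ⟨h, fun w hw => (hr.2 w hw).trans (hs.2 w (hw.trans_le h)).symm⟩

theorem le_total_of_le {r s t : GuessingSeq W A} (hr : r ≤ t) (hs : s ≤ t) : r ≤ s ∨ s ≤ r :=
  (le_total r.len s.len).imp (le_of_le_of_len_le hr hs) (le_of_le_of_len_le hs hr)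

theorem eq_of_le_of_len_eq {s t : GuessingSeq W A} (h : s ≤ t) (hl : s.len = t.len) : s = t :=
  le_antisymm h (le_of_le_of_len_le le_rfl h hl.ge)

theorem len_strictMono : StrictMono (len : GuessingSeq W A → W) := fun _ _ h =>
  lt_of_le_of_ne h.le.1 fun hl => h.ne (eq_of_le_of_len_eq h.le hl)

instance [WellFoundedLT W] : WellFoundedLT (GuessingSeq W A) :=
  StrictMono.wellFoundedLT len_strictMono

/-- The initial segment of length `b` of a sequence. -/
def restrict (t : GuessingSeq W A) (b : W) (hb : b ≤ t.len) : GuessingSeq W A where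
  len := b
  val w := if w < b then t.val w else default
  val_of_le w hw := if_neg hw.not_gt
  fst_lt v w hvw hw := by
    rw [if_pos hw, if_pos (hvw.trans hw)]
    exact t.fst_lt v w hvw (hw.trans_le hb)
  guess c hc hlim := (t.guess c (hc.trans hb) hlim).congr fun _ hw =>
    (if_pos (hw.trans_le hc)).symm

@[simp] theorem restrict_len (t : GuessingSeq W A) (b : W) (hb : b ≤ t.len) :
    (t.restrict b hb).len = b := rfl

theorem restrict_le (t : GuessingSeq W A) (b : W) (hb : b ≤ t.len) : t.restrict b hb ≤ t :=
  ⟨hb, fun _ hw => if_pos hw⟩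

theorem restrict_lt (t : GuessingSeq W A) (b : W) (hb : b < t.len) : t.restrict b hb.le < t :=
  lt_of_le_of_ne (t.restrict_le b hb.le) fun h => hb.ne (congrArg len h)

theorem restrict_len_of_le {s t : GuessingSeq W A} (h : s ≤ t) : t.restrict s.len h.1 = s :=
  eq_of_le_of_len_eq (le_of_le_of_len_le (restrict_le ..) h le_rfl) rfl

/-- The strict initial segments of `t` are its restrictions to the elements below `t.len`. -/
def iioEquiv (t : GuessingSeq W A) : Set.Iio t ≃o Set.Iio t.len where
  toFun s := ⟨s.1.len, len_strictMono s.2⟩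
  invFun b := ⟨t.restrict b.1 b.2.le, t.restrict_lt b.1 b.2⟩
  left_inv s := Subtype.ext (restrict_len_of_le s.2.le)
  right_inv _ := rfl
  map_rel_iff' {r s} := ⟨fun h => le_of_le_of_len_le r.2.le s.2.le h, fun h => h.1⟩

instance [WellFoundedLT W] : IsOrderTree (GuessingSeq W A) where
  wo t := (RelIso.toRelEmbedding (t.iioEquiv.toRelIsoLT)).isWellOrder

theorem ht_eq [WellFoundedLT W] (t : GuessingSeq W A) :
    OrderTree.ht t = Ordinal.typein (α := W) (· < ·) t.len :=
  Ordinal.type_eq.2 ⟨t.iioEquiv.toRelIsoLT⟩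

/-- The empty sequence. -/
def empty (b : W) (hb : IsMin b) : GuessingSeq W A where
  len := b
  val _ := default
  val_of_le _ _ := rfl
  fst_lt _ _ _ hw := (hb.not_lt hw).elim
  guess _ hc hlim := (hlim.1 (hb.mono hc)).elim

theorem empty_le (b : W) (hb : IsMin b) (t : GuessingSeq W A) : empty b hb ≤ t :=
  ⟨hb.isBot _, fun _ hw => (hb.not_lt hw).elim⟩

theorem existsUnique_isMin (b : W) (hb : IsMin b) : ∃! r : GuessingSeq W A, IsMin r :=
  ⟨empty b hb, fun _ _ => empty_le b hb _,
    fun r hr => le_antisymm (hr (empty_le b hb r)) (empty_le b hb r)⟩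

theorem isMin_of_isMin_len {t : GuessingSeq W A} (h : IsMin t.len) : IsMin t := fun _ hs =>
  le_of_le_of_len_le le_rfl hs (h hs.1)

/-- A sequence of limit length has no last term, so it is determined by its strict initial
segments. -/
theorem noLimitSplit [WellFoundedLT W] [SuccOrder W] :
    OrderTree.NoLimitSplit (GuessingSeq W A) := by
  intro s t hlim hht hIio
  rw [ht_eq] at hlim
  rw [ht_eq, ht_eq] at hht
  have hl : s.len = t.len := (Ordinal.typein_inj _).1 hht
  have hs : IsSuccLimit s.len := (PrincipalSeg.isSuccLimit_apply_iff
    (Ordinal.typein (α := W) (· < ·))).1 hlim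
  refine eq_of_le_of_len_eq ⟨hl.le, fun w hw => ?_⟩ hl
  have hw' : succ w < s.len := hs.succ_lt hw
  have hlt := s.restrict_lt (succ w) hw'
  have ht : s.restrict (succ w) hw'.le ≤ t := le_of_lt (hIio ▸ hlt : _ ∈ Set.Iio t)
  have hwm : w < succ w := lt_succ_of_not_isMax hw.not_isMax
  exact (hlt.le.2 w hwm).symm.trans (ht.2 w hwm)

/-- The extension of a sequence by one term. Limit conditions are not affected. -/
def snoc [SuccOrder W] [NoMaxOrder W] (t : GuessingSeq W A) (p : K × M)
    (hp : ∀ w < t.len, (t.val w).1 < p.1) : GuessingSeq W A where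
  len := succ t.len
  val w := if w = t.len then p else t.val w
  val_of_le w hw := by
    rw [succ_le_iff] at hw
    rw [if_neg hw.ne', t.val_of_le w hw.le]
  fst_lt v w hvw hw := by
    rw [lt_succ_iff] at hw
    rw [if_neg (hvw.trans_le hw).ne]
    rcases hw.eq_or_lt with h | h
    · rw [if_pos h]
      exact hp v (h ▸ hvw)
    · rw [if_neg h.ne]
      exact t.fst_lt v w hvw h
  guess c hc hlim := by
    have hc' : c ≤ t.len := by
      rcases hc.eq_or_lt with h | h
      · exact (not_isSuccLimit_succ _ (h ▸ hlim)).elim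
      · exact lt_succ_iff.1 h
    exact (t.guess c hc' hlim).congr fun w hw => (if_neg (hw.trans_le hc').ne).symm

theorem snoc_val_len [SuccOrder W] [NoMaxOrder W] (t : GuessingSeq W A) (p : K × M)
    (hp : ∀ w < t.len, (t.val w).1 < p.1) : (t.snoc p hp).val t.len = p := if_pos rfl

theorem lt_snoc [SuccOrder W] [NoMaxOrder W] (t : GuessingSeq W A) (p : K × M)
    (hp : ∀ w < t.len, (t.val w).1 < p.1) : t < t.snoc p hp :=
  lt_of_le_of_ne ⟨le_succ _, fun _ hw => (if_neg hw.ne).symm⟩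
    fun h => (lt_succ t.len).ne (congrArg len h)

/-- A sequence of sequences, each extending the previous one, has an upper bound as soon as the
limit condition holds for its union. -/
theorem exists_forall_le [WellFoundedLT W] (hW : ∀ a : ℕ → W, ∃ b, ∀ n, a n < b)
    (t : ℕ → GuessingSeq W A) (ht : Monotone t) (δ : K)
    (hδ : IsLUB {k | ∃ n, ∃ w < (t n).len, ((t n).val w).1 = k} δ)
    (hA : ∀ x, ∃ n, ∃ w < (t n).len, ((t n).val w).2 ∈ A δ ∧ x < ((t n).val w).2) :
    ∃ q : GuessingSeq W A, ∀ n, t n ≤ q := by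
  classical
  -- `b` is the supremum of the lengths.
  obtain ⟨b, hb, hbmin⟩ : ∃ b, (∀ n, (t n).len ≤ b) ∧ ∀ w < b, ∃ n, w < (t n).len := by
    obtain ⟨b₀, hb₀⟩ := hW fun n => (t n).len
    obtain ⟨b, hb, hmin⟩ := WellFounded.has_min (wellFounded_lt (α := W))
      {b | ∀ n, (t n).len ≤ b} ⟨b₀, fun n => (hb₀ n).le⟩
    refine ⟨b, hb, fun w hw => ?_⟩
    by_contra! h
    exact hmin w h hw
  let val : W → K × M := fun w =>
    if h : ∃ n, w < (t n).len then (t (Nat.find h)).val w else default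
  have hval : ∀ n, ∀ w < (t n).len, val w = (t n).val w := by
    intro n w hw
    have h : ∃ n, w < (t n).len := ⟨n, hw⟩
    simp only [val, dif_pos h]
    exact (ht (Nat.find_min' h hw)).2 w (Nat.find_spec h)
  refine ⟨⟨b, val, fun w hw => ?_, fun v w hvw hw => ?_, fun c hc hlim => ?_⟩,
    fun n => ⟨hb n, fun w hw => (hval n w hw).symm⟩⟩
  · exact dif_neg fun ⟨n, hn⟩ => (hn.trans_le (hb n)).not_ge hw
  · obtain ⟨n, hn⟩ := hbmin w hw
    rw [hval n w hn, hval n v (hvw.trans hn)]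
    exact (t n).fst_lt v w hvw hn
  · rcases hc.lt_or_eq with hc | rfl
    · obtain ⟨n, hn⟩ := hbmin c hc
      exact ((t n).guess c hn.le hlim).congr fun w hw => (hval n w (hw.trans hn)).symm
    · refine ⟨δ, ?_, fun x => ?_⟩
      · convert hδ using 2
        ext k
        constructor
        · rintro ⟨w, hw, rfl⟩
          obtain ⟨n, hn⟩ := hbmin w hw
          exact ⟨n, w, hn, by rw [hval n w hn]⟩
        · rintro ⟨n, w, hw, rfl⟩
          exact ⟨w, hw.trans_le (hb n), by rw [hval n w hw]⟩
      · obtain ⟨n, w, hw, hx⟩ := hA x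
        exact ⟨w, hw.trans_le (hb n), by rwa [hval n w hw]⟩

/-! ### Distributivity -/

/-- The intersection of countably many dense upward closed sets is dense. Sets `G n` of at most
`#M` sequences and ordinals `γ n` above all first coordinates occurring in `G n` are built so that
every `t ∈ G n` and `x : M` have an extension in `G (n + 1) ∩ D n` whose next term is `(γ n, x)`.
For `δ = sup γ n`, following a cofinal `ω`-sequence of elements of `A δ` through the sets `G n`
gives a branch whose union guesses `A`. -/
theorem exists_le_forall_mem [WellFoundedLT K] [WellFoundedLT W] [SuccOrder W] [NoMaxOrder W]
    (hW : ∀ a : ℕ → W, ∃ b, ∀ n, a n < b) (hM : ℵ₀ ≤ #M) (hWM : #W ≤ #M)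
    (hK : ∀ {ι : Type u} (f : ι → K), #ι ≤ #M → ∃ b, ∀ i, f i < b)
    (hcof : ∃ c : ℕ → M, ∀ x, ∃ n, x ≤ c n) (hA : ∀ k x, ∃ y ∈ A k, x < y)
    (D : ℕ → Set (GuessingSeq W A)) (hD : ∀ n, IsUpperSet (D n))
    (hdense : ∀ n t, ∃ q ∈ D n, t ≤ q) (s : GuessingSeq W A) :
    ∃ q, s ≤ q ∧ ∀ n, q ∈ D n := by
  have hstep : ∀ (n : ℕ) (G : {G : Set (GuessingSeq W A) // #G ≤ #M}), ∃ (γ : K)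
      (G' : {G : Set (GuessingSeq W A) // #G ≤ #M}),
      (∀ t ∈ G.1, ∀ w < t.len, (t.val w).1 < γ) ∧ ∀ t ∈ G.1, ∀ x : M, ∃ t' ∈ G'.1,
        t ≤ t' ∧ t' ∈ D n ∧ t.len < t'.len ∧ t'.val t.len = (γ, x) := by
    rintro n ⟨G, hG⟩
    -- `γ` bounds the first coordinates of at most `#M * #W ≤ #M` terms.
    obtain ⟨γ, hγ⟩ := hK (fun p : G × W => (p.1.1.val p.2).1) (by
      rw [mk_prod, lift_id, lift_id]
      exact mul_le_of_le hM hG hWM)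
    choose e he hle using hdense n
    let ext : G × M → GuessingSeq W A := fun p =>
      e (p.1.1.snoc (γ, p.2) fun w _ => hγ (p.1, w))
    refine ⟨γ, ⟨Set.range ext, mk_range_le.trans ?_⟩, fun t ht w _ => hγ (⟨t, ht⟩, w),
      fun t ht x => ?_⟩
    · rw [mk_prod, lift_id, lift_id]
      exact mul_le_of_le hM hG le_rfl
    · have hγt : ∀ w < t.len, (t.val w).1 < ((γ, x) : K × M).1 := fun w _ => hγ (⟨t, ht⟩, w)
      have hlt := (t.lt_snoc (γ, x) hγt).trans_le (hle (t.snoc (γ, x) hγt))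
      refine ⟨_, ⟨(⟨t, ht⟩, x), rfl⟩, hlt.le, he _, len_strictMono hlt, ?_⟩
      rw [← (hle (t.snoc (γ, x) hγt)).2 t.len (lt_succ _), snoc_val_len]
  choose γ' G' hγ' hG' using hstep
  let G : ℕ → {G : Set (GuessingSeq W A) // #G ≤ #M} := fun n =>
    Nat.rec ⟨{s}, by rw [mk_singleton]; exact one_le_aleph0.trans hM⟩ G' n
  let γ : ℕ → K := fun n => γ' n (G n)
  obtain ⟨δ, hδ⟩ : ∃ δ, IsLUB (Set.range γ) δ := by
    obtain ⟨b, hb⟩ := hK (fun n : ULift.{u} ℕ => γ n.down) (by simpa using hM)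
    obtain ⟨δ, hδ, hmin⟩ := WellFounded.has_min (wellFounded_lt (α := K))
      (upperBounds (Set.range γ)) ⟨b, by rintro _ ⟨n, rfl⟩; exact (hb ⟨n⟩).le⟩
    exact ⟨δ, hδ, fun y hy => not_lt.1 (hmin y hy)⟩
  obtain ⟨c, hc⟩ := hcof
  -- `δ` is fixed before the second coordinates, so these can be taken in `A δ`, cofinally.
  choose α hα hcα using fun n => hA δ (c n)
  have hpath : ∀ (n : ℕ) (t : (G n).1), ∃ t' : (G (n + 1)).1, t.1 ≤ t'.1 ∧ t'.1 ∈ D n ∧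
      t.1.len < t'.1.len ∧ t'.1.val t.1.len = (γ n, α n) := by
    rintro n ⟨t, ht⟩
    obtain ⟨t', ht', h⟩ := hG' n (G n) t ht (α n)
    exact ⟨⟨t', ht'⟩, h⟩
  choose next hnext using hpath
  let t : ∀ n, (G n).1 := fun n => Nat.rec ⟨s, rfl⟩ next n
  have ht : ∀ n, (t n).1 ≤ (t (n + 1)).1 ∧ (t (n + 1)).1 ∈ D n ∧
      (t n).1.len < (t (n + 1)).1.len ∧ (t (n + 1)).1.val (t n).1.len = (γ n, α n) :=
    fun n => hnext n (t n)
  obtain ⟨q, hq⟩ := exists_forall_le hW (fun n => (t n).1)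
    (monotone_nat_of_le_succ fun n => (ht n).1) δ (by
      refine ⟨?_, fun y hy => hδ.2 ?_⟩
      · rintro _ ⟨n, w, hw, rfl⟩
        exact (hγ' n (G n) _ (t n).2 w hw).le.trans (hδ.1 ⟨n, rfl⟩)
      · rintro _ ⟨n, rfl⟩
        exact hy ⟨n + 1, _, (ht n).2.2.1, by rw [(ht n).2.2.2]⟩) (by
      intro x
      obtain ⟨n, hn⟩ := hc x
      refine ⟨n + 1, _, (ht n).2.2.1, ?_⟩
      rw [(ht n).2.2.2]
      exact ⟨hα n, hn.trans_lt (hcα n)⟩)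
  exact ⟨q, hq 0, fun n => hD n (hq (n + 1)) (ht n).2.1⟩

/-- Over any sequence there are arbitrarily long ones: at limit lengths this is an instance of
the density of countable intersections of dense upward closed sets. -/
theorem exists_le_len [WellFoundedLT W] [SuccOrder W] [NoMaxOrder W]
    (hWc : ∀ w : W, (Set.Iio w).Countable)
    (hK : ∀ t : GuessingSeq W A, ∃ b, ∀ w < t.len, (t.val w).1 < b)
    (hbaire : ∀ D : ℕ → Set (GuessingSeq W A), (∀ n, IsUpperSet (D n)) →
      (∀ n t, ∃ q ∈ D n, t ≤ q) → ∀ s, ∃ q, s ≤ q ∧ ∀ n, q ∈ D n)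
    (w : W) (s : GuessingSeq W A) : ∃ q, s ≤ q ∧ w ≤ q.len := by
  induction w using WellFoundedLT.induction generalizing s with
  | ind w ih =>
    rcases (Set.Iio w).eq_empty_or_nonempty with h | h
    · exact ⟨s, le_rfl, le_of_not_gt fun hlt => (h ▸ hlt : s.len ∈ (∅ : Set W))⟩
    · obtain ⟨a, ha⟩ := (hWc w).exists_eq_range h
      obtain ⟨q, hsq, hq⟩ := hbaire (fun n => {t | a n < t.len})
        (fun n t t' htt' ht => lt_of_lt_of_le ht htt'.1) (fun n t => by
          obtain ⟨q, htq, hq⟩ := ih (a n) (ha ▸ Set.mem_range_self n : a n ∈ Set.Iio w) t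
          obtain ⟨b, hb⟩ := hK q
          have hlt := q.lt_snoc (b, default) hb
          exact ⟨_, hq.trans_lt (len_strictMono hlt), htq.trans hlt.le⟩) s
      refine ⟨q, hsq, le_of_not_gt fun hlt => ?_⟩
      obtain ⟨n, hn⟩ : q.len ∈ Set.range a := ha ▸ hlt
      exact (hn ▸ hq n : a n < a n).false

theorem nontriv [SuccOrder W] [NoMaxOrder W] [NoMaxOrder K]
    (hK : ∀ t : GuessingSeq W A, ∃ b, ∀ w < t.len, (t.val w).1 < b) :
    OrderTree.Nontriv (GuessingSeq W A) := by
  intro t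
  obtain ⟨b, hb⟩ := hK t
  obtain ⟨b', hb'⟩ := exists_gt b
  refine ⟨t.snoc (b, default) hb, t.snoc (b', default) fun w hw => (hb w hw).trans hb',
    (t.lt_snoc _ _).le, (t.lt_snoc _ _).le, ?_⟩
  rintro ⟨r, h, h'⟩
  have h₁ := h.2 t.len (lt_succ _)
  have h₂ := h'.2 t.len (lt_succ _)
  rw [snoc_val_len] at h₁ h₂
  exact hb'.ne (congrArg Prod.fst (h₁.trans h₂.symm))

/-! ### Specialness of small subtrees -/

/-- If the sets `A i`, `i ≤ γ`, can be made disjoint by removing initial segments, then the tree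
of guessing sequences with first coordinates at most `γ` is special. A sequence of limit length
with supremum `δ` is sent to its restriction to some `w` with `x_w ∈ A δ \ F δ`; comparable
sequences with the same image would have different suprema and the same `x_w`. A sequence of
successor length is sent to its immediate predecessor. -/
theorem isSpecial_of_disjoint [WellFoundedLT W] [SuccOrder W] [NoMaxOrder W] (γ : K) (F : K → M)
    (hF : ∀ i ≤ γ, ∀ j ≤ γ, i ≠ j → Disjoint (A i \ Set.Iio (F i)) (A j \ Set.Iio (F j))) :
    OrderTree.IsSpecial {t : GuessingSeq W A // ∀ w < t.len, (t.val w).1 ≤ γ} := by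
  classical
  set Z := {t : GuessingSeq W A // ∀ w < t.len, (t.val w).1 ≤ γ}
  -- The length of the image of `t` under the regressive map.
  have hreg : ∀ t : Z, ∃ b, ¬ IsMin t.1.len → b < t.1.len ∧
      (¬ IsSuccLimit t.1.len → t.1.len = succ b) ∧ (IsSuccLimit t.1.len → ∃ δ,
        IsLUB {k | ∃ w < t.1.len, (t.1.val w).1 = k} δ ∧
        (t.1.val b).2 ∈ A δ \ Set.Iio (F δ)) := by
    intro t
    by_cases hlim : IsSuccLimit t.1.len
    · obtain ⟨δ, hδ, h⟩ := t.1.guess _ le_rfl hlim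
      obtain ⟨w, hw, hA, hlt⟩ := h (F δ)
      exact ⟨w, fun _ => ⟨hw, fun h => (h hlim).elim, fun _ => ⟨δ, hδ, hA, hlt.not_gt⟩⟩⟩
    · rcases not_isSuccLimit_iff.1 hlim with h | h
      · exact ⟨t.1.len, fun h' => (h' h).elim⟩
      · obtain ⟨b, hb⟩ := not_isSuccPrelimit_iff.1 h
        exact ⟨b, fun _ => ⟨hb.lt, fun _ => hb.succ_eq.symm, fun h => (hlim h).elim⟩⟩
  choose b hb using hreg
  have hlt := fun t h => (hb t h).1
  have hsucc := fun t h => (hb t h).2.1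
  have hlim := fun t h => (hb t h).2.2
  let res : ∀ (t : Z) (c : W), c ≤ t.1.len → Z := fun t c hc => ⟨t.1.restrict c hc, fun w hw =>
    ((t.1.restrict_le c hc).2 w hw ▸ t.2 w (lt_of_lt_of_le hw hc))⟩
  have hmin : ∀ t : Z, ¬ IsMin t → ¬ IsMin t.1.len := fun t ht h =>
    ht fun s hs => isMin_of_isMin_len h hs
  have hlen : ∀ t : Z, IsMin t → IsMin t.1.len := fun t ht c hc =>
    (ht (show res t c hc ≤ t from t.1.restrict_le c hc)).1
  let f : Z → Z := fun t => if h : IsMin t then t else res t (b t) (hlt t (hmin t h)).le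
  have hf : ∀ t (h : ¬ IsMin t), f t = res t (b t) (hlt t (hmin t h)).le := fun t h => dif_neg h
  have hwf : WellFoundedLT Z := StrictMono.wellFoundedLT (Subtype.strictMono_coe _)
  refine isSpecial_of_regressive (fun {r s t} hr hs => le_total_of_le (t := t.1) hr hs)
    (fun {s t} hs ht => ?_) f (fun t ht => ?_) (fun t => if IsSuccLimit t.1.len then 1 else 0)
    (fun s t hs ht hst hfe hc => ?_)
  · refine Subtype.ext (eq_of_le_of_len_eq ⟨(hlen s hs).isBot _, fun w hw => ?_⟩ ?_)
    · exact ((hlen s hs).not_lt hw).elim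
    · exact le_antisymm ((hlen s hs).isBot _) ((hlen t ht).isBot _)
  · rw [hf t ht]
    exact t.1.restrict_lt _ (hlt t (hmin t ht))
  -- The two colours distinguish limit from successor length, and in each case sequences of the
  -- same colour in a common fiber are incomparable.
  · have hst' : s.1 < t.1 := hst
    have hbeq : b s = b t := by
      rw [hf s hs, hf t ht] at hfe
      exact congrArg (fun z : Z => z.1.len) hfe
    have hll := len_strictMono hst'
    by_cases hls : IsSuccLimit s.1.len <;> by_cases hlt' : IsSuccLimit t.1.len <;>
      simp only [hls, hlt', if_true, if_false, one_ne_zero, zero_ne_one] at hc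
    · obtain ⟨δ, hδ, hx⟩ := hlim s (hmin s hs) hls
      obtain ⟨ε, hε, hy⟩ := hlim t (hmin t ht) hlt'
      have hle : ∀ (z : Z) (η : K), IsLUB {k | ∃ w < z.1.len, (z.1.val w).1 = k} η → η ≤ γ :=
        fun z η h => h.2 (by rintro _ ⟨w, hw, rfl⟩; exact z.2 w hw)
      have h₁ : δ ≤ (t.1.val s.1.len).1 := hδ.2 (by
        rintro _ ⟨w, hw, rfl⟩
        rw [hst'.le.2 w hw]
        exact (t.1.fst_lt w _ hw hll).le)
      have hsl : succ s.1.len < t.1.len := hlt'.succ_lt hll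
      have hδε : δ < ε := h₁.trans_lt
        ((t.1.fst_lt _ _ (lt_succ _) hsl).trans_le (hε.1 ⟨_, hsl, rfl⟩))
      rw [hst'.le.2 _ (hlt s (hmin s hs)), hbeq] at hx
      exact Set.disjoint_left.1 (hF δ (hle s δ hδ) ε (hle t ε hε) hδε.ne) hx hy
    · have h := hsucc s (hmin s hs) hls
      rw [hbeq, ← hsucc t (hmin t ht) hlt'] at h
      exact hll.ne h

end GuessingSeq

/-! ### Distributivity from dense upward closed sets -/

/-- A name for an `ω`-sequence is decided by any condition in the intersection of the dense sets
of conditions that decide its `n`-th term. -/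
theorem OrderTree.isOmegaDistributive_of_dense {P : Type u} [PartialOrder P] (hP : Nontriv P)
    (h : ∀ D : ℕ → Set P, (∀ n, IsUpperSet (D n)) → (∀ n t, ∃ q ∈ D n, t ≤ q) →
      ∀ s, ∃ q, s ≤ q ∧ ∀ n, q ∈ D n) : IsOmegaDistributive P := by
  refine ⟨hP, fun τ p => ?_⟩
  obtain ⟨q, hpq, hq⟩ := h (fun n => {t | ∃ a, τ.decides t n a})
    (fun n t t' htt' ⟨a, ha⟩ => ⟨a, τ.mono htt' ha⟩)
    (fun n t => let ⟨q, htq, hq⟩ := τ.total t n; ⟨q, hq, htq⟩) p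
  choose g hg using hq
  exact ⟨q, hpq, g, fun n r hr => ⟨r, le_rfl, τ.mono hr (hg n)⟩⟩

/-! ### Initial ordinals as well-ordered types -/

theorem Order.exists_forall_lt_of_mk_lt_cof {K ι : Type u} [LinearOrder K] (h : #ι < Order.cof K)
    (f : ι → K) : ∃ b, ∀ i, f i < b := by
  have : ¬ IsCofinal (Set.range f) := fun hc =>
    ((Order.cof_le hc).trans mk_range_le).not_gt h
  obtain ⟨b, hb⟩ := not_isCofinal_iff.1 this
  exact ⟨b, fun i => hb _ ⟨i, rfl⟩⟩

theorem Order.exists_nat_of_cof_eq_aleph0 {M : Type u} [LinearOrder M] [Nonempty M]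
    (h : Order.cof M = ℵ₀) : ∃ c : ℕ → M, ∀ x, ∃ n, x ≤ c n := by
  obtain ⟨s, hs, hcard⟩ := Order.exists_cof_eq M
  obtain ⟨c, hc⟩ := (le_aleph0_iff_set_countable.1 (hcard.trans h).le).exists_eq_range hs.nonempty
  refine ⟨c, fun x => ?_⟩
  obtain ⟨y, hy, hxy⟩ := hs x
  rw [hc] at hy
  obtain ⟨n, rfl⟩ := hy
  exact ⟨n, hxy⟩

/-- `ADS_μ` transferred from the sets of ordinals below `μ⁺` and `μ`, which live one universe
higher, to well-ordered types in the universe of `μ`. -/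
theorem ADS.exists_toType {μ : Cardinal.{u}} (hμ : ℵ₀ ≤ μ) (h : ADS μ) :
    ∃ A : (succ μ).ord.ToType → Set μ.ord.ToType, (∀ k x, ∃ y ∈ A k, x < y) ∧
      ∀ γ, ∃ F : (succ μ).ord.ToType → μ.ord.ToType, ∀ i ≤ γ, ∀ j ≤ γ, i ≠ j →
        Disjoint (A i \ Set.Iio (F i)) (A j \ Set.Iio (F j)) := by
  classical
  obtain ⟨A, hA, hF⟩ := h
  let eK := Ordinal.ToType.mk (o := (succ μ).ord)
  let eM := Ordinal.ToType.mk (o := μ.ord)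
  have : NoMaxOrder (succ μ).ord.ToType := Cardinal.noMaxOrder (hμ.trans (le_succ μ))
  refine ⟨fun k => {x | eM.symm x ∈ A (eK.symm k)}, fun k x => ?_, fun γ => ?_⟩
  · obtain ⟨y, hy, hxy⟩ := hA (eK.symm k) (eM.symm x)
    exact ⟨eM y, by simpa using hy, (OrderIso.symm_apply_lt _).1 hxy⟩
  · obtain ⟨β, hβ⟩ := exists_gt γ
    obtain ⟨F, hF⟩ := hF (eK.symm β)
    have hlt : ∀ i ≤ γ, eK.symm i < eK.symm β := fun i hi =>
      eK.symm.lt_iff_lt.2 (hi.trans_lt hβ)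
    have : Inhabited μ.ord.ToType := ⟨eM (F ⟨eK.symm γ, hlt γ le_rfl⟩)⟩
    refine ⟨fun i => if h : eK.symm i < eK.symm β then eM (F ⟨eK.symm i, h⟩) else default,
      fun i hi j hj hij => Set.disjoint_left.2 fun x hx hy => ?_⟩
    have hne : (⟨eK.symm i, hlt i hi⟩ : Set.Iio (eK.symm β)) ≠ ⟨eK.symm j, hlt j hj⟩ :=
      fun h => hij (eK.symm.injective (congrArg Subtype.val h))
    simp only [dif_pos (hlt i hi)] at hx
    simp only [dif_pos (hlt j hj)] at hy
    have hdisj := Set.disjoint_left.1 (hF _ _ hne)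
    refine @hdisj (eM.symm x) ⟨hx.1, fun h => hx.2 ?_⟩ ⟨hy.1, fun h => hy.2 ?_⟩
    · exact (OrderIso.symm_apply_lt (x := F _) eM).1 h
    · exact (OrderIso.symm_apply_lt (x := F _) eM).1 h

/-! ### The failure of `ADS` -/

namespace BaireRadoConjecture

/-- The abstract form of the argument, for linear orders `K` and `M` with the relevant properties
of `μ⁺` and `μ`. -/
theorem not_disjointifiable (hRC : BaireRadoConjecture.{u}) {K M : Type u} [LinearOrder K]
    [LinearOrder M] [WellFoundedLT K] [NoMaxOrder K] (hM : ℵ₁ ≤ #M)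
    (hK : ∀ {ι : Type u} (f : ι → K), #ι ≤ #M → ∃ b, ∀ i, f i < b)
    (hcof : Order.cof M = ℵ₀) (A : K → Set M) (hA : ∀ k x, ∃ y ∈ A k, x < y) :
    ∃ γ, ∀ F : K → M, ∃ i ≤ γ, ∃ j ≤ γ, i ≠ j ∧
      ¬ Disjoint (A i \ Set.Iio (F i)) (A j \ Set.Iio (F j)) := by
  by_contra! hF
  let W : Type u := (Ordinal.omega.{u} 1).ToType
  have hWcard : #W = ℵ₁ := by simp [W]
  have hcofW : Order.cof W = ℵ₁ := by rw [Ordinal.cof_toType, cof_omega_one]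
  have hW : ∀ a : ℕ → W, ∃ b, ∀ n, a n < b := fun a => by
    obtain ⟨b, hb⟩ := exists_forall_lt_of_mk_lt_cof (K := W) (ι := ULift.{u} ℕ)
      (by rw [hcofW]; simp) (fun n => a n.down)
    exact ⟨b, fun n => hb ⟨n⟩⟩
  have hWc : ∀ w : W, (Set.Iio w).Countable := fun w => by
    rw [← le_aleph0_iff_set_countable, ← lt_succ_iff, succ_aleph0, ← hWcard]
    exact mk_Iio_lt w (by rw [hWcard, ord_aleph]; exact (Ordinal.type_toType _).symm)
  have : NoMaxOrder W := ⟨fun w => (hW fun _ => w).imp fun b hb => hb 0⟩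
  have hM₀ : ℵ₀ ≤ #M := (aleph0_le_aleph 1).trans hM
  have : Nonempty M := mk_ne_zero_iff.1 (aleph0_pos.trans_le hM₀).ne'
  have : Nonempty K := ⟨(hK (ι := PEmpty) PEmpty.elim (by simp)).choose⟩
  have : Nonempty W := mk_ne_zero_iff.1 (by rw [hWcard]; exact (aleph_pos 1).ne')
  inhabit M
  inhabit K
  have hWM : #W ≤ #M := hWcard.le.trans hM
  have hbdd : ∀ t : GuessingSeq W A, ∃ b, ∀ w < t.len, (t.val w).1 < b := fun t =>
    (hK (fun w : W => (t.val w).1) hWM).imp fun b hb w _ => hb w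
  have hbaire := GuessingSeq.exists_le_forall_mem hW hM₀ hWM hK
    (exists_nat_of_cof_eq_aleph0 hcof) hA
  obtain ⟨w₀, hw₀⟩ : ∃ w : W, IsMin w := by
    obtain ⟨w, _, hw⟩ := WellFounded.has_min (wellFounded_lt (α := W)) Set.univ Set.univ_nonempty
    exact ⟨w, isMin_iff_forall_not_lt.2 fun v => hw v trivial⟩
  have hheight : OrderTree.HasHeight (GuessingSeq W A) (Ordinal.omega 1) := by
    refine ⟨fun t => ?_, fun a ha => le_of_forall_lt fun o ho => ?_⟩
    · rw [GuessingSeq.ht_eq]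
      exact Ordinal.typein_lt_self _
    · obtain ⟨w, rfl⟩ : ∃ w : W, Ordinal.typein (α := W) (· < ·) w = o :=
        Ordinal.typein_surj _ (by rwa [Ordinal.type_toType])
      obtain ⟨q, _, hq⟩ := GuessingSeq.exists_le_len hWc hbdd hbaire w (GuessingSeq.empty w₀ hw₀)
      simpa [GuessingSeq.ht_eq] using ha (q.restrict w hq)
  have hnontriv : OrderTree.Nontriv (GuessingSeq W A) := GuessingSeq.nontriv hbdd
  obtain ⟨X, hX, hns⟩ := hRC (GuessingSeq W A)
    ⟨hheight, hnontriv, GuessingSeq.existsUnique_isMin w₀ hw₀, GuessingSeq.noLimitSplit⟩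
    (OrderTree.isOmegaDistributive_of_dense hnontriv hbaire)
  -- Since `#X = ℵ₁ ≤ #M`, the first coordinates occurring in `X` are bounded in `K`.
  obtain ⟨γ, hγ⟩ := hK (fun p : X × W => (p.1.1.val p.2).1) (by
    rw [mk_prod, lift_id, lift_id]
    exact mul_le_of_le hM₀ (hX.le.trans hM) hWM)
  obtain ⟨F, hF⟩ := hF γ
  exact hns ((GuessingSeq.isSpecial_of_disjoint γ F hF).of_orderEmbedding
    { toFun := fun t => ⟨t.1, fun w _ => (hγ (t, w)).le⟩
      inj' := fun s t h => Subtype.ext (congrArg (fun z => z.1) h)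
      map_rel_iff' := Iff.rfl })

end BaireRadoConjecture

theorem mainTheorem9 (hRC : BaireRadoConjecture.{u}) (μ : Cardinal.{u}) (hμ : μ.IsSingular)
    (hcof : μ.ord.cof = Cardinal.aleph0) : ¬ ADS μ := by
  intro hADS
  have hμ₁ : ℵ₁ ≤ μ := by
    rw [← succ_aleph0, succ_le_iff]
    exact lt_of_le_of_ne hμ.aleph0_le fun h => hμ.cof_ord_ne (hcof.trans h)
  obtain ⟨A, hA, hF⟩ := hADS.exists_toType hμ.aleph0_le
  have : NoMaxOrder (succ μ).ord.ToType := Cardinal.noMaxOrder (hμ.aleph0_le.trans (le_succ μ))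
  have hcard : #μ.ord.ToType = μ := mk_ord_toType μ
  obtain ⟨γ, hγ⟩ := hRC.not_disjointifiable (hμ₁.trans hcard.ge) (fun f hι =>
    exists_forall_lt_of_mk_lt_cof (by
      rw [Ordinal.cof_toType, (isRegular_succ hμ.aleph0_le).cof_ord, lt_succ_iff]
      exact hι.trans hcard.le) f) ((Ordinal.cof_toType _).trans hcof) A hA
  obtain ⟨F, hF⟩ := hF γ
  obtain ⟨i, hi, j, hj, hij, h⟩ := hγ F
  exact h (hF i hi j hj hij)
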